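/- Let $A$ be the free group on a finite set $\{a_1,\dots,a_n\}$, let $B$ be a group, let $\varphi\colon A\to\mathrm{Aut}(B)$ be a homomorphism, and suppose that $G=B\rtimes_\varphi A$ is finitely generated. Let $T$ be the Cayley graph of $A$ with respect to $\{a_1,\dots,a_n\}$, a locally finite tree with edges of length $1$, and let $\rho$ be the isometric action of $G$ on $T$ obtained by composing the projection $G\to A$ with the left multiplication action of $A$ on $T$. For a geodesic ray $\tau\colon[0,\infty)\to T$ and $s\in\mathbb{R}$ put $HB_s(\tau)=\bigcup_{l\ge\max\{0,s\}}\overline{\mathrm{Ball}}_{\,l-s}(\tau(l))$. Choose a contractible free $G$-CW-complex $\tilde X$ whose $1$-skeleton is cocompact, and a continuous $G$-map $h\colon\tilde X^{(1)}\to T$; let $\tilde X_{(\tau,s)}$ be the largest subcomplex of $\tilde X^{(1)}$ contained in $h^{-1}(HB_s(\tau))$. The action $\rho$ is controlled connected over the end point $\tau(\infty)\in\partial T$ if there is a function $\lambda\colon\mathbb{R}\to[0,\infty)$ with $s-\lambda(s)\to\infty$ as $s\to\infty$ such that for every $s\in\mathbb{R}$ any two points of $\tilde X_{(\tau,s)}$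 can be joined by a path in $\tilde X_{(\tau,s-\lambda(s))}$. (This property does not depend on the choices of $\tilde X$, $h$ and of the ray $\tau$ representing the end point; below, non-membership is asserted for every choice.) Let $\Sigma^1(\rho)\subseteq\partial T$ be the set of end points over which $\rho$ is controlled connected. For a letter $t\in\{a_1,\dots,a_n\}^{\pm1}$ and $a\in A$ let $\mathrm{expsum}_t(a)\in\mathbb{Z}$ be the exponent sum of $t$ in the reduced word of $a$, i.e. the number of occurrences of $t$ minus the number of occurrences of $t^{-1}$. Say that $B$ is finitely generated over a subset $A'\subseteq A$ if there is a finite set $S\subseteq B$ such that $\{\varphi_a(s)\mid s\in S,\ a\in A'\}$ generates $B$. An end point $e\in\partial T$ is represented by the infinite freely reduced word $c_1c_2c_3\cdots$ in the letters $a_i^{\pm1}$ if $e=\tau(\infty)$ for a geodesic ray $\tau$ with $\tau(k)=c_1c_2\cdots c_k$ for all integers $k\ge 0$. **Corollary.** Let $t\in\{a_1,\dots,a_n\}^{\pm1}$, and suppose that there is no $m\in\mathbb{Z}$ such that $B$ is finitely generated over $A\setminus\mathrm{expsum}_t^{-1}([m,\infty))$. Then no end point $e\in\partial T$ represented by an infinite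 word that eventually consists only of the letter $t^{-1}$ lies in $\Sigma^1(\rho)$. -/

import Mathlib

open Set Filter Topology
open scoped NNReal unitInterval

/-! ## Geometric realization of a graph, with its length metric -/

section Realization

variable {V : Type*} (Γ : SimpleGraph V)

/-- A point of the geometric realization of the simplicial graph `Γ`, in barycentric coordinates:
a convex combination `(1 - s) u + s v` of two vertices `u`, `v` that are equal or adjacent. -/
@[ext] structure GraphRealization where
  coord : V →₀ ℝ
  isPoint : ∃ (u v : V) (s : I), (u = v ∨ Γ.Adj u v) ∧
    coord = Finsupp.single u (1 - (s : ℝ)) + Finsupp.single v (s : ℝ)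

namespace GraphRealization

variable {Γ}

/-- The point `v` of the realization. -/
noncomputable def vertex (Γ : SimpleGraph V) (v : V) : GraphRealization Γ where
  coord := Finsupp.single v 1
  isPoint := ⟨v, v, 0, Or.inl rfl, by simp⟩

/-- The point at parameter `s` on the (closed) edge from `u` to `v`. -/
noncomputable def edgePoint {u v : V} (h : Γ.Adj u v) (s : I) : GraphRealization Γ where
  coord := Finsupp.single u (1 - (s : ℝ)) + Finsupp.single v (s : ℝ)
  isPoint := ⟨u, v, s, Or.inr h, rfl⟩

/-- `Chain p q r`: there is a finite sequence of points from `p` to `q`, any two consecutive ones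
lying on a common closed edge, of total length `r`; here each edge is a copy of `[0, 1]`. -/
inductive Chain : GraphRealization Γ → GraphRealization Γ → ℝ → Prop
  | nil (p : GraphRealization Γ) : Chain p p 0
  | cons {u v : V} (h : Γ.Adj u v) (s s' : I) {q : GraphRealization Γ} {r : ℝ} :
      Chain (edgePoint h s') q r → Chain (edgePoint h s) q (|(s : ℝ) - s'| + r)

/-- The length (path) metric on the realization: the infimum of the lengths of chains. -/
noncomputable def chainDist (p q : GraphRealization Γ) : ℝ := sInf {r : ℝ | Chain p q r}

theorem edgePoint_zero {u v : V} (h : Γ.Adj u v) : edgePoint h 0 = vertex Γ u := by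
  ext1; simp [edgePoint, vertex]

theorem edgePoint_one {u v : V} (h : Γ.Adj u v) : edgePoint h 1 = vertex Γ v := by
  ext1; simp [edgePoint, vertex]

theorem eq_vertex_or_edgePoint (p : GraphRealization Γ) :
    (∃ v, p = vertex Γ v) ∨ ∃ (u v : V) (h : Γ.Adj u v) (s : I), p = edgePoint h s := by
  obtain ⟨u, v, s, h | h, hp⟩ := p.isPoint
  · subst h
    refine Or.inl ⟨u, ?_⟩
    ext1
    rw [hp, ← Finsupp.single_add]
    simp [vertex]
  · exact Or.inr ⟨u, v, h, s, by ext1; exact hp⟩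

namespace Chain

variable {p q x : GraphRealization Γ} {r r' : ℝ}

theorem nonneg (h : Chain p q r) : 0 ≤ r := by
  induction h with
  | nil => exact le_rfl
  | cons _ s s' _ ih => exact add_nonneg (abs_nonneg _) ih

theorem trans (h : Chain p q r) (h' : Chain q x r') : Chain p x (r + r') := by
  induction h with
  | nil => simpa using h'
  | cons e s s' _ ih => rw [add_assoc]; exact Chain.cons e s s' (ih h')

theorem single {u v : V} (h : Γ.Adj u v) (s s' : I) :
    Chain (edgePoint h s) (edgePoint h s') |(s : ℝ) - s'| := by
  simpa using Chain.cons h s s' (Chain.nil (edgePoint h s'))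

theorem symm (h : Chain p q r) : Chain q p r := by
  induction h with
  | nil p => exact Chain.nil p
  | cons e s s' _ ih =>
    rw [add_comm, abs_sub_comm]
    exact ih.trans (single e s' s)

end Chain

/-- The affine extension to the realization of a function on the vertices. -/
noncomputable def affineExt (f : V → ℝ) (p : GraphRealization Γ) : ℝ :=
  p.coord.sum fun a x => x * f a

theorem affineExt_edgePoint (f : V → ℝ) {u v : V} (h : Γ.Adj u v) (s : I) :
    affineExt f (edgePoint h s) = (1 - (s : ℝ)) * f u + s * f v := by
  unfold affineExt edgePoint
  rw [Finsupp.sum_add_index' (by simp) (by intros; ring), Finsupp.sum_single_index (by simp),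
    Finsupp.sum_single_index (by simp)]

theorem affineExt_vertex (f : V → ℝ) (v : V) : affineExt f (vertex Γ v) = f v := by
  simp [affineExt, vertex]

/-- A function on the vertices that changes by at most `1` along edges extends to a function on
the realization that is `1`-Lipschitz along chains. -/
theorem Chain.abs_affineExt_sub_le {f : V → ℝ} (hf : ∀ u v, Γ.Adj u v → |f u - f v| ≤ 1)
    {p q : GraphRealization Γ} {r : ℝ} (h : Chain p q r) :
    |affineExt f p - affineExt f q| ≤ r := by
  induction h with
  | nil => simp
  | @cons u v e s s' q r _ ih =>
    have h1 : |affineExt f (edgePoint e s) - affineExt f (edgePoint e s')| ≤ |(s : ℝ) - s'| := by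
      rw [affineExt_edgePoint, affineExt_edgePoint]
      have : (1 - (s : ℝ)) * f u + s * f v - ((1 - (s' : ℝ)) * f u + s' * f v)
          = -(((s : ℝ) - s') * (f u - f v)) := by ring
      rw [this, abs_neg, abs_mul]
      exact mul_le_of_le_one_right (abs_nonneg _) (hf u v e)
    exact (abs_sub_le _ _ _).trans (add_le_add h1 ih)

theorem Chain.abs_coord_sub_le {p q : GraphRealization Γ} {r : ℝ} (h : Chain p q r) (w : V) :
    |p.coord w - q.coord w| ≤ r := by
  classical
  have key : ∀ x : GraphRealization Γ,
      affineExt (fun a => if a = w then (1 : ℝ) else 0) x = x.coord w := by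
    intro x
    simp +contextual [affineExt, Finsupp.sum, eq_comm]
  have := h.abs_affineExt_sub_le (f := fun a => if a = w then (1 : ℝ) else 0) (by
    intro u v _
    split_ifs <;> norm_num)
  rwa [key, key] at this

theorem bddBelow_chain (p q : GraphRealization Γ) : BddBelow {r : ℝ | Chain p q r} :=
  ⟨0, fun _ h => Chain.nonneg h⟩

theorem exists_chain_vertex (p : GraphRealization Γ) : ∃ v r, Chain p (vertex Γ v) r := by
  rcases eq_vertex_or_edgePoint p with ⟨v, rfl⟩ | ⟨u, v, h, s, rfl⟩
  · exact ⟨v, 0, Chain.nil _⟩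
  · exact ⟨u, _, edgePoint_zero h ▸ Chain.single h s 0⟩

theorem exists_chain (hΓ : Γ.Connected) (p q : GraphRealization Γ) :
    {r : ℝ | Chain p q r}.Nonempty := by
  have hv : ∀ u v : V, ∃ r, Chain (vertex Γ u) (vertex Γ v) r := by
    intro u v
    obtain ⟨w⟩ := hΓ.preconnected u v
    induction w with
    | nil => exact ⟨0, Chain.nil _⟩
    | cons h _ ih =>
      obtain ⟨r, hr⟩ := ih
      have h1 := Chain.single h 0 1
      rw [edgePoint_zero, edgePoint_one] at h1
      exact ⟨_, h1.trans hr⟩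
  obtain ⟨u, r₁, h₁⟩ := exists_chain_vertex p
  obtain ⟨v, r₂, h₂⟩ := exists_chain_vertex q
  obtain ⟨r, hr⟩ := hv u v
  exact ⟨_, (h₁.trans hr).trans h₂.symm⟩

/-- The realization of a connected graph is a metric space under the length metric. -/
noncomputable instance [hΓ : Fact Γ.Connected] : MetricSpace (GraphRealization Γ) where
  dist := chainDist
  dist_self p := le_antisymm (csInf_le (bddBelow_chain p p) (Chain.nil p))
    (Real.sInf_nonneg fun _ h => Chain.nonneg h)
  dist_comm p q := by
    have : {r : ℝ | Chain p q r} = {r : ℝ | Chain q p r} :=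
      Set.ext fun _ => ⟨Chain.symm, Chain.symm⟩
    simp only [chainDist, this]
  dist_triangle p q x := by
    have hpq := exists_chain hΓ.out p q
    have hqx := exists_chain hΓ.out q x
    refine le_of_forall_pos_lt_add fun ε hε => ?_
    obtain ⟨r, hr, hr'⟩ := exists_lt_of_csInf_lt hpq (lt_add_of_pos_right _ (half_pos hε))
    obtain ⟨s, hs, hs'⟩ := exists_lt_of_csInf_lt hqx (lt_add_of_pos_right _ (half_pos hε))
    have := csInf_le (bddBelow_chain p x) (Chain.trans hr hs)
    unfold chainDist
    linarith
  eq_of_dist_eq_zero {p q} h := by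
    ext w
    have hle : |p.coord w - q.coord w| ≤ chainDist p q :=
      le_csInf (exists_chain hΓ.out p q) fun _ hr => Chain.abs_coord_sub_le hr w
    rw [show chainDist p q = 0 from h] at hle
    exact sub_eq_zero.1 (abs_nonpos_iff.1 hle)

theorem dist_eq_chainDist [Fact Γ.Connected] (p q : GraphRealization Γ) :
    dist p q = chainDist p q := rfl

/-- The map of realizations induced by a graph automorphism, affine on edges. -/
noncomputable def map (f : Γ ≃g Γ) (p : GraphRealization Γ) : GraphRealization Γ where
  coord := p.coord.mapDomain f
  isPoint := by
    obtain ⟨u, v, s, h, hp⟩ := p.isPoint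
    refine ⟨f u, f v, s, h.imp (congrArg f) f.map_adj_iff.2, ?_⟩
    rw [hp, Finsupp.mapDomain_add, Finsupp.mapDomain_single, Finsupp.mapDomain_single]

theorem map_one (p : GraphRealization Γ) : map 1 p = p := by
  ext1
  exact Finsupp.mapDomain_id (v := p.coord)

theorem map_mul (f g : Γ ≃g Γ) (p : GraphRealization Γ) : map (f * g) p = map f (map g p) := by
  ext1
  exact Finsupp.mapDomain_comp (v := p.coord) (f := g) (g := f)

theorem map_vertex (f : Γ ≃g Γ) (v : V) : map f (vertex Γ v) = vertex Γ (f v) := by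
  ext1
  simp [map, vertex, Finsupp.mapDomain_single]

theorem map_edgePoint (f : Γ ≃g Γ) {u v : V} (h : Γ.Adj u v) (s : I) :
    map f (edgePoint h s) = edgePoint (f.map_adj_iff.2 h) s := by
  ext1
  simp only [map, edgePoint, Finsupp.mapDomain_add, Finsupp.mapDomain_single]

theorem Chain.map (f : Γ ≃g Γ) {p q : GraphRealization Γ} {r : ℝ} (h : Chain p q r) :
    Chain (p.map f) (q.map f) r := by
  induction h with
  | nil => exact Chain.nil _
  | cons e s s' _ ih =>
    rw [map_edgePoint] at ih ⊢
    exact Chain.cons _ s s' ih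

theorem chain_map_iff (f : Γ ≃g Γ) {p q : GraphRealization Γ} {r : ℝ} :
    Chain (map f p) (map f q) r ↔ Chain p q r := by
  refine ⟨fun h => ?_, Chain.map f⟩
  have := h.map f⁻¹
  rwa [← map_mul, ← map_mul, inv_mul_cancel, map_one, map_one] at this

/-- Graph automorphisms act on the realization by isometries. -/
noncomputable def autHom [Fact Γ.Connected] :
    (Γ ≃g Γ) →* (GraphRealization Γ ≃ᵢ GraphRealization Γ) where
  toFun f :=
    { toFun := map f
      invFun := map f⁻¹
      left_inv := fun p => by rw [← map_mul, inv_mul_cancel, map_one]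
      right_inv := fun p => by rw [← map_mul, mul_inv_cancel, map_one]
      isometry_toFun := Isometry.of_dist_eq fun p q => by
        simp only [dist_eq_chainDist, chainDist, chain_map_iff] }
  map_one' := by ext1 p; exact map_one p
  map_mul' f g := by ext1 p; exact map_mul f g p

end GraphRealization

end Realization

/-! ## Geodesic rays, the boundary, horoballs -/

section Boundary

variable (M : Type*) [MetricSpace M]

/-- A (unit speed) geodesic ray in `M`. -/
structure GeodesicRay where
  toFun : ℝ≥0 → M
  isometry : Isometry toFun

instance : CoeFun (GeodesicRay M) fun _ => ℝ≥0 → M := ⟨GeodesicRay.toFun⟩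

/-- Two rays are asymptotic if they stay at bounded distance from each other. -/
def GeodesicRay.asymptotic : Setoid (GeodesicRay M) where
  r τ τ' := ∃ C : ℝ, ∀ s, dist (τ s) (τ' s) ≤ C
  iseqv :=
    { refl := fun _ => ⟨0, fun _ => by simp⟩
      symm := fun ⟨C, h⟩ => ⟨C, fun s => by rw [dist_comm]; exact h s⟩
      trans := fun ⟨C, h⟩ ⟨C', h'⟩ =>
        ⟨C + C', fun s => (dist_triangle _ _ _).trans (add_le_add (h s) (h' s))⟩ }

/-- The boundary `∂M` at infinity: geodesic rays up to being asymptotic. -/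
def Boundary : Type _ := Quotient (GeodesicRay.asymptotic M)

variable {M}

/-- The end point `τ(∞)`. -/
def GeodesicRay.endpoint (τ : GeodesicRay M) : Boundary M :=
  Quotient.mk (GeodesicRay.asymptotic M) τ

/-- The horoball `HB_k(τ)`, the union over `l ≥ max (0, k)` of the closed balls of radius `l - k`
about `τ(l)`; it shrinks towards `τ(∞)` as `k` increases. -/
def horoball (τ : GeodesicRay M) (k : ℝ) : Set M :=
  ⋃ (l : ℝ≥0) (_ : k ≤ l), Metric.closedBall (τ l) (l - k)

end Boundary

/-! ## Controlled connectivity and the invariant `Σ¹` -/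

section Sigma

open Topology.RelCWComplex

universe u v

variable {G : Type u} [Group G] {M : Type v} [MetricSpace M]

/-- A choice of data for testing controlled connectivity of the action `ρ`:
a contractible free `G`-CW-complex `X` (that is, the universal cover of a `K(G,1)`-complex) with
cocompact `1`-skeleton, and a continuous `G`-map from its `1`-skeleton to `M`. -/
structure ControlMap (ρ : G →* (M ≃ᵢ M)) where
  X : Type u
  [top : TopologicalSpace X]
  [t2 : T2Space X]
  [cw : CWComplex (univ : Set X)]
  [contractible : ContractibleSpace X]
  [act : MulAction G X]
  [contAct : ContinuousConstSMul G X]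
  /-- `G` permutes the open cells -/
  permutes : ∀ (g : G) (m : ℕ) (i : cell (univ : Set X) m), ∃ j : cell (univ : Set X) m,
    (fun x => g • x) '' openCell m i = openCell m j
  /-- and does so freely; -/
  free : ∀ (g : G) (m : ℕ) (i : cell (univ : Set X) m),
    (fun x => g • x) '' openCell m i = openCell m i → g = 1
  /-- there are finitely many orbits of cells of dimension at most one. -/
  cocompact : ∀ m ≤ 1, ∃ F : Finset (cell (univ : Set X) m), ∀ j : cell (univ : Set X) m,
    ∃ i ∈ F, ∃ g : G, (fun x => g • x) '' openCell m i = openCell m j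
  /-- The map to `M`; only its values on the `1`-skeleton matter. -/
  h : X → M
  continuousOn : ContinuousOn h (skeleton (univ : Set X) 1 : Set X)
  equivariant : ∀ (g : G), ∀ x ∈ skeleton (univ : Set X) 1, h (g • x) = ρ g (h x)

attribute [instance] ControlMap.top ControlMap.t2 ControlMap.cw ControlMap.contractible
  ControlMap.act ControlMap.contAct

/-- The largest subcomplex of the `1`-skeleton that is contained in `h⁻¹(HB_t(τ))`, as a set. -/
def ControlMap.sub {ρ : G →* (M ≃ᵢ M)} (D : ControlMap ρ) (τ : GeodesicRay M) (t : ℝ) :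
    Set D.X :=
  ⋃ (E : Subcomplex (univ : Set D.X))
    (_ : (E : Set D.X) ⊆ (skeleton (univ : Set D.X) 1 : Set D.X) ∩ D.h ⁻¹' horoball τ t),
    (E : Set D.X)

/-- `h` is controlled connected over `τ(∞)`: there is a lag `lag(t) ≥ 0` with
`t - lag(t) → ∞` as `t → ∞` such that, for all `t`, any two points of `X_(τ,t)` can be joined
by a path in `X_(τ,t - lag(t))`. -/
def ControlMap.ControlledConnected {ρ : G →* (M ≃ᵢ M)} (D : ControlMap ρ) (τ : GeodesicRay M) :
    Prop :=
  ∃ lag : ℝ → ℝ, (∀ t, 0 ≤ lag t) ∧ Tendsto (fun t => t - lag t) atTop atTop ∧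
    ∀ t, ∀ x ∈ D.sub τ t, ∀ y ∈ D.sub τ t, JoinedIn (D.sub τ (t - lag t)) x y

/-- `Σ¹(ρ)`, for an isometric action `ρ` of a finitely generated group `G` on a proper CAT(0)
space `M`: the end points over which `ρ` is controlled connected. For such actions the property
does not depend on the choice of the complex and the map; here it is asked for
some choice, so that a point lies outside `Σ¹(ρ)` when every choice fails. -/
def Sigma1 (ρ : G →* (M ≃ᵢ M)) : Set (Boundary M) :=
  {e | ∃ τ : GeodesicRay M, τ.endpoint = e ∧ ∃ D : ControlMap ρ, D.ControlledConnected τ}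

end Sigma

/-! ## The Cayley tree of a free group -/

section CayleyTree

variable (α : Type*)

/-- The Cayley graph of the free group on `α` with respect to the basis `α`. -/
abbrev freeCayleyGraph : SimpleGraph (FreeGroup α) :=
  SimpleGraph.mulCayley (range (FreeGroup.of : α → FreeGroup α))

theorem freeCayleyGraph_connected : (freeCayleyGraph α).Connected := by
  have step : ∀ (a : FreeGroup α) (i : α),
      (freeCayleyGraph α).Reachable a (a * FreeGroup.of i) := by
    intro a i
    refine SimpleGraph.Adj.reachable ?_
    rw [SimpleGraph.mulCayley_adj']
    refine ⟨fun h => ?_, _, ⟨i, rfl⟩, Or.inl rfl⟩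
    exact FreeGroup.of_ne_one i (mul_eq_left.1 h.symm)
  have key : ∀ g a : FreeGroup α, (freeCayleyGraph α).Reachable a (a * g) := by
    intro g
    induction g using FreeGroup.induction_on with
    | C1 => intro a; rw [mul_one]
    | of i => intro a; exact step a i
    | inv_of i _ => intro a; simpa using (step (a * (FreeGroup.of i)⁻¹) i).symm
    | mul x y hx hy => intro a; rw [← mul_assoc]; exact (hx a).trans (hy (a * x))
  have : Nonempty (FreeGroup α) := ⟨1⟩
  refine SimpleGraph.Connected.mk fun a b => ?_
  simpa using key (a⁻¹ * b) a

instance : Fact (freeCayleyGraph α).Connected := ⟨freeCayleyGraph_connected α⟩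

/-- The Cayley tree of the free group on `α`, as a metric space. -/
abbrev CayleyTree : Type _ := GraphRealization (freeCayleyGraph α)

/-- The free group acts on its Cayley graph by left multiplication. -/
def cayleyLeftMul : FreeGroup α →* (freeCayleyGraph α ≃g freeCayleyGraph α) where
  toFun a :=
    { toEquiv := Equiv.mulLeft a
      map_rel_iff' := by
        intro u v
        simp only [SimpleGraph.mulCayley_adj', Equiv.coe_mulLeft, mul_assoc, ne_eq,
          mul_right_inj] }
  map_one' := by ext; simp
  map_mul' a b := by ext; simp

variable {α} {B : Type*} [Group B]

/-- The action `ρ` of `G = B ⋊ A` on the Cayley tree of the free group `A`: project to `A` and let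
`A` act by left multiplication. -/
noncomputable def semidirectAction (φ : FreeGroup α →* MulAut B) :
    (B ⋊[φ] FreeGroup α) →* (CayleyTree α ≃ᵢ CayleyTree α) :=
  (GraphRealization.autHom.comp (cayleyLeftMul α)).comp SemidirectProduct.rightHom

/-- A letter `(a, true)` stands for the generator `a`, the letter `(a, false)` for its inverse;
`invLetter` inverts a letter. -/
def invLetter (t : α × Bool) : α × Bool := (t.1, !t.2)

/-- The end point `e` of the Cayley tree is represented by the infinite word `c₀c₁c₂…`: it is the
end point of a geodesic ray `τ` with `τ(k) = c₀c₁…c_{k-1}` for all `k`. In particular `τ(0) = 1`,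
and the word is freely reduced because `τ` is geodesic. -/
def RepresentedBy (e : Boundary (CayleyTree α)) (c : ℕ → α × Bool) : Prop :=
  ∃ τ : GeodesicRay (CayleyTree α), τ.endpoint = e ∧ ∀ k : ℕ,
    τ (k : ℝ≥0) = GraphRealization.vertex _ (FreeGroup.mk ((List.range k).map c))

/-- The exponent sum of the letter `t` in the reduced word of `a`: the number of occurrences of
`t` minus the number of occurrences of `t⁻¹`. -/
def expsum [DecidableEq α] (t : α × Bool) (a : FreeGroup α) : ℤ :=
  (a.toWord.count t : ℤ) - a.toWord.count (invLetter t)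

/-- `B` is finitely generated over the subset `A'` of `A`: for some finite `S ⊆ B` the elements
`φ_a(s)` (which is `a s a⁻¹` in `B ⋊ A`), `s ∈ S`, `a ∈ A'`, generate `B`. -/
def FinGenOver {A : Type*} [Group A] (φ : A →* MulAut B) (A' : Set A) : Prop :=
  ∃ S : Finset B, Subgroup.closure {b | ∃ a ∈ A', ∃ s ∈ S, b = φ a s} = ⊤

end CayleyTree

/-! ## Height functions on horoballs of the Cayley tree -/

section ExponentSum

/-! By contraposition: controlled connectivity over `e` yields generators for `B`. The exponent sum
of `t` extends to a 1-Lipschitz height on the tree. Along a ray that eventually reads only `t⁻¹` it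
drops at unit speed, which offsets the growing radii of the balls in a horoball, so it is bounded
above on every horoball (`exists_treeHeight_le_of_mem_horoball`).

Since `B` acts trivially on the tree, a vertex `x₀` and its translate `b • x₀` have the same image
there. For suitable `s` both lie over `HB_s`, hence are joined by a path over the larger horoball
`HB_(s - lag s)`, where the height is at most some `K`. Label the vertices by elements of `G`. By
cocompactness and freeness, the two labels of an edge are `g q` and `g q'` with `q`, `q'` from a
finite set `Q` (`exists_vertex_labelling`), and the height bound forces the exponent sum of
`g.right` below a fixed `m`. The `B`-component of `g q` is `g.left * φ g.right q.left`, so along the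
path it changes only by elements `φ a s` and their inverses, with `a` of exponent sum below `m` and
`s` from a finite set. These elements therefore generate every `b`.

The path need not be an edge path: `JoinedIn.iff_of_vertex_property` replaces the walk from vertex
to vertex by a connectedness argument. -/

theorem semidirectAction_inl {α B : Type*} [Group B] (φ : FreeGroup α →* MulAut B) (b : B)
    (p : CayleyTree α) : semidirectAction φ (SemidirectProduct.inl b) p = p := by
  simp [semidirectAction]

variable {α : Type*} [DecidableEq α]

/-- The homomorphism to `ℤ` that sends the letter `t` to `1` and all other generators to `0`. -/
def expsumHom (t : α × Bool) : FreeGroup α →* Multiplicative ℤ :=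
  FreeGroup.lift fun i => Multiplicative.ofAdd (if i = t.1 then (if t.2 then 1 else -1) else 0)

/-- Both sides are additive under concatenation, so single letters suffice. Any word may thus be
used, reduced or not, and `expsum` inherits additivity from the homomorphism. -/
theorem toAdd_expsumHom_mk (t : α × Bool) (L : List (α × Bool)) :
    (expsumHom t (FreeGroup.mk L)).toAdd = (L.count t : ℤ) - L.count (invLetter t) := by
  induction L with
  | nil => simp [← FreeGroup.one_eq_mk]
  | cons x L ih =>
    have hx : FreeGroup.mk (x :: L) = FreeGroup.mk [x] * FreeGroup.mk L := by
      simp [FreeGroup.mul_mk]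
    rw [hx, map_mul, toAdd_mul, ih]
    obtain ⟨i, b⟩ := x
    obtain ⟨j, b'⟩ := t
    by_cases hij : i = j <;> cases b <;> cases b' <;>
      simp [expsumHom, invLetter, hij] <;> ring

theorem toAdd_expsumHom (t : α × Bool) (a : FreeGroup α) :
    (expsumHom t a).toAdd = expsum t a := by
  rw [expsum, ← toAdd_expsumHom_mk, FreeGroup.mk_toWord]

theorem expsum_one (t : α × Bool) : expsum t 1 = 0 := by
  rw [← toAdd_expsumHom, map_one, toAdd_one]

theorem expsum_mul (t : α × Bool) (a b : FreeGroup α) :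
    expsum t (a * b) = expsum t a + expsum t b := by
  simp only [← toAdd_expsumHom, map_mul, toAdd_mul]

theorem expsum_mk (t : α × Bool) (L : List (α × Bool)) :
    expsum t (FreeGroup.mk L) = (L.count t : ℤ) - L.count (invLetter t) := by
  rw [← toAdd_expsumHom, toAdd_expsumHom_mk]

theorem abs_expsum_of_le_one (t : α × Bool) (i : α) : |expsum t (FreeGroup.of i)| ≤ 1 := by
  rw [← toAdd_expsumHom]
  simp only [expsumHom, FreeGroup.lift_apply_of, toAdd_ofAdd]
  split_ifs <;> simp

theorem abs_expsum_sub_le_of_adj (t : α × Bool) {u v : FreeGroup α}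
    (h : (freeCayleyGraph α).Adj u v) : |(expsum t u : ℝ) - expsum t v| ≤ 1 := by
  rw [SimpleGraph.mulCayley_adj'] at h
  obtain ⟨-, _, ⟨i, rfl⟩, h | h⟩ := h
  · rw [← h, expsum_mul]
    push_cast
    rw [sub_add_cancel_left, abs_neg]
    exact_mod_cast abs_expsum_of_le_one t i
  · rw [h, expsum_mul]
    push_cast
    rw [add_sub_cancel_left]
    exact_mod_cast abs_expsum_of_le_one t i

/-- The affine extension of the exponent sum to the Cayley tree. -/
noncomputable def treeHeight (t : α × Bool) (p : CayleyTree α) : ℝ :=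
  GraphRealization.affineExt (fun a => (expsum t a : ℝ)) p

theorem treeHeight_vertex (t : α × Bool) (a : FreeGroup α) :
    treeHeight t (GraphRealization.vertex _ a) = expsum t a :=
  GraphRealization.affineExt_vertex _ a

theorem abs_treeHeight_sub_le_dist (t : α × Bool) (p q : CayleyTree α) :
    |treeHeight t p - treeHeight t q| ≤ dist p q :=
  le_csInf (GraphRealization.exists_chain (freeCayleyGraph_connected α) p q) fun _ hr =>
    hr.abs_affineExt_sub_le fun _ _ => abs_expsum_sub_le_of_adj t

theorem treeHeight_semidirectAction {B : Type*} [Group B] (φ : FreeGroup α →* MulAut B)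
    (t : α × Bool) (g : B ⋊[φ] FreeGroup α) (p : CayleyTree α) :
    treeHeight t (semidirectAction φ g p) = expsum t g.right + treeHeight t p := by
  change treeHeight t (GraphRealization.map (cayleyLeftMul α g.right) p) = _
  rcases GraphRealization.eq_vertex_or_edgePoint p with ⟨v, rfl⟩ | ⟨u, v, h, s, rfl⟩
  · rw [GraphRealization.map_vertex, treeHeight_vertex, treeHeight_vertex]
    change ((expsum t (g.right * v) : ℤ) : ℝ) = _
    rw [expsum_mul]
    push_cast
    rfl
  · rw [GraphRealization.map_edgePoint]
    simp only [treeHeight, GraphRealization.affineExt_edgePoint]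
    change (1 - (s : ℝ)) * (expsum t (g.right * u) : ℤ) + s * (expsum t (g.right * v) : ℤ) = _
    rw [expsum_mul, expsum_mul]
    push_cast
    ring

theorem expsum_mk_range_le {t : α × Bool} {c : ℕ → α × Bool} {N : ℕ}
    (hc : ∀ i ≥ N, c i = invLetter t) (j : ℕ) :
    expsum t (FreeGroup.mk ((List.range (N + j)).map c))
      = expsum t (FreeGroup.mk ((List.range N).map c)) - j := by
  have ht : invLetter t ≠ t := by
    obtain ⟨i, b⟩ := t
    cases b <;> simp [invLetter]
  induction j with
  | zero => simp
  | succ j ih =>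
    rw [expsum_mk] at ih ⊢
    rw [← add_assoc, List.range_succ, List.map_append, List.count_append, List.count_append]
    have h1 : List.count t (List.map c [N + j]) = 0 := by
      simp [hc (N + j) (by omega), ht]
    have h2 : List.count (invLetter t) (List.map c [N + j]) = 1 := by
      simp [hc (N + j) (by omega)]
    rw [h1, h2]
    push_cast
    linarith

/-- The exponent sum of `t` is bounded above on horoballs centred at an end point represented by a
word that eventually consists of `t⁻¹` only. -/
theorem exists_treeHeight_le_of_mem_horoball {t : α × Bool} {c : ℕ → α × Bool}
    (hc : ∃ N : ℕ, ∀ i ≥ N, c i = invLetter t) {τ : GeodesicRay (CayleyTree α)}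
    (hτ : RepresentedBy τ.endpoint c) (s : ℝ) :
    ∃ K : ℝ, ∀ y ∈ horoball τ s, treeHeight t y ≤ K := by
  obtain ⟨N, hN⟩ := hc
  obtain ⟨τ₀, h₀, hv⟩ := hτ
  obtain ⟨C, hC⟩ := (Quotient.exact h₀ : (GeodesicRay.asymptotic _).r τ₀ τ)
  -- For `N + j ≥ l`, `y` is within `(l - s) + (N + j - l) + C` of `τ₀ (N + j)`, whose height is
  -- that of the prefix of length `N` minus `j`; both `l` and `j` cancel. `C` allows for `τ` being
  -- only asymptotic to the ray `τ₀` that spells the word.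
  refine ⟨expsum t (FreeGroup.mk ((List.range N).map c)) + N - s + C, fun y hy => ?_⟩
  simp only [horoball, mem_iUnion, Metric.mem_closedBall] at hy
  obtain ⟨l, -, hl⟩ := hy
  obtain ⟨j, hj⟩ := exists_nat_ge (l : ℝ)
  have hlL : dist (τ l) (τ ((N + j : ℕ) : ℝ≥0)) = (N + j : ℕ) - (l : ℝ) := by
    rw [τ.isometry.dist_eq, NNReal.dist_eq, abs_sub_comm, abs_of_nonneg] <;>
      push_cast <;> linarith [(N.cast_nonneg : (0 : ℝ) ≤ N)]
  have h1 := dist_triangle y (τ l) (τ ((N + j : ℕ) : ℝ≥0))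
  have h2 := dist_triangle y (τ ((N + j : ℕ) : ℝ≥0)) (τ₀ ((N + j : ℕ) : ℝ≥0))
  have h3 := hC ((N + j : ℕ) : ℝ≥0)
  rw [dist_comm] at h3
  have h4 := (le_abs_self _).trans
    (abs_treeHeight_sub_le_dist t y (τ₀ ((N + j : ℕ) : ℝ≥0)))
  have h5 : treeHeight t (τ₀ ((N + j : ℕ) : ℝ≥0))
      = expsum t (FreeGroup.mk ((List.range N).map c)) - j := by
    rw [hv, treeHeight_vertex, expsum_mk_range_le hN]
    push_cast
    rfl
  rw [hlL] at h1
  push_cast at *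
  linarith

end ExponentSum

/-! ## Paths in graphs inside a CW complex -/

section OneDimensional

open Topology.RelCWComplex

variable {X : Type*} [TopologicalSpace X] [CWComplex (univ : Set X)]

theorem exists_mem_openCell_zero_of_mem_cellFrontier_one {e : cell (univ : Set X) 1} {u : X}
    (hu : u ∈ cellFrontier 1 e) : ∃ v : cell (univ : Set X) 0, u ∈ openCell 0 v := by
  obtain ⟨x, y, h⟩ := CWComplex.exists_cellFrontier_one_eq e
  simp only [h, closedCell_zero_eq_singleton, ← openCell_zero_eq_singleton] at hu
  exact hu.elim (fun h => ⟨x, h⟩) fun h => ⟨y, h⟩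

theorem finite_cellFrontier_one (e : cell (univ : Set X) 1) : (cellFrontier 1 e).Finite := by
  rw [cellFrontier_one_eq]
  exact (toFinite _).image _

theorem eq_of_mem_openCell {m n : ℕ} {i : cell (univ : Set X) m} {j : cell (univ : Set X) n}
    {x : X} (hi : x ∈ openCell m i) (hj : x ∈ openCell n j) :
    (⟨m, i⟩ : Σ n, cell (univ : Set X) n) = ⟨n, j⟩ := by
  by_contra h
  exact (disjoint_openCell_of_ne h).notMem_of_mem_left hi hj

/-- A cell of least dimension has dimension zero: otherwise its frontier would be nonempty and
covered by cells of smaller dimension. -/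
theorem exists_cell_zero [Nonempty X] : Nonempty (cell (univ : Set X) 0) := by
  classical
  obtain ⟨x⟩ := ‹Nonempty X›
  have hex : ∃ n, Nonempty (cell (univ : Set X) n) := by
    have hx : x ∈ ⋃ (n : ℕ) (j : cell (univ : Set X) n), closedCell n j := by
      rw [CWComplex.union]; trivial
    simp only [mem_iUnion] at hx
    obtain ⟨n, j, -⟩ := hx
    exact ⟨n, ⟨j⟩⟩
  obtain ⟨j⟩ := Nat.find_spec hex
  by_cases h0 : Nat.find hex = 0
  · exact h0 ▸ ⟨j⟩
  · obtain ⟨y, hy⟩ := nonempty_cellFrontier h0 j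
    obtain ⟨J, hJ⟩ := CWComplex.cellFrontier_subset_finite_closedCell _ j
    have := hJ hy
    simp only [mem_iUnion] at this
    obtain ⟨m, hm, i, -, -⟩ := this
    exact absurd ⟨i⟩ (Nat.find_min hex hm)

/-- The cells of dimension at most one in `Y` all of whose vertices satisfy `P`. -/
def cellsWithVertices (Y : Set X) (P : X → Prop) : ∀ n, Set (cell (univ : Set X) n)
  | 0 => {v | openCell 0 v ⊆ Y ∧ ∀ x ∈ openCell 0 v, P x}
  | 1 => {e | closedCell 1 e ⊆ Y ∧ ∀ x ∈ cellFrontier 1 e, P x}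
  | _ + 2 => ∅

variable [T2Space X]

/-- The ends of a selected edge are selected vertices: they lie in `Y` with the closed edge and
satisfy `P` by the frontier condition. The purpose is closedness, which every subcomplex has. -/
theorem exists_subcomplex_eq_iUnion_cellsWithVertices (Y : Set X) (P : X → Prop) :
    ∃ E : Subcomplex (univ : Set X),
      (E : Set X) = ⋃ (n : ℕ) (j : cellsWithVertices Y P n), openCell (C := univ) n j.1 := by
  refine ⟨CWComplex.Subcomplex.mk' (univ : Set X) _ (cellsWithVertices Y P) ?_ rfl, rfl⟩
  rintro (_ | _ | n) ⟨i, hi⟩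
  · rw [closedCell_zero_eq_singleton, ← openCell_zero_eq_singleton]
    exact subset_iUnion_of_subset 0 (subset_iUnion_of_subset ⟨i, hi⟩ subset_rfl)
  · change closedCell 1 i ⊆ _
    rw [← cellFrontier_union_openCell_eq_closedCell]
    refine union_subset (fun x hx => ?_)
      (subset_iUnion_of_subset 1 (subset_iUnion_of_subset ⟨i, hi⟩ subset_rfl))
    obtain ⟨v, hv⟩ := exists_mem_openCell_zero_of_mem_cellFrontier_one hx
    simp only [mem_iUnion]
    refine ⟨0, ⟨v, ?_⟩, hv⟩
    have hs : ∀ y ∈ openCell 0 v, y = x := by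
      rw [openCell_zero_eq_singleton, mem_singleton_iff] at hv
      rw [openCell_zero_eq_singleton, hv]
      exact fun y hy => hy
    refine ⟨fun y hy => ?_, fun y hy => ?_⟩
    · rw [hs y hy]
      exact hi.1 (cellFrontier_subset_closedCell 1 i hx)
    · rw [hs y hy]
      exact hi.2 x hx
  · exact hi.elim

theorem isClosed_iUnion_cellsWithVertices (Y : Set X) (P : X → Prop) :
    IsClosed (⋃ (n : ℕ) (j : cellsWithVertices Y P n), openCell (C := univ) n j.1) := by
  obtain ⟨E, hE⟩ := exists_subcomplex_eq_iUnion_cellsWithVertices Y P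
  exact hE ▸ E.closed

/-- In a union of closed cells of dimension at most one, a property of vertices that is shared by
the end points of every edge is constant along paths. -/
theorem JoinedIn.iff_of_vertex_property {Y : Set X}
    (hY : ∀ y ∈ Y, ∃ n ≤ 1, ∃ i : cell (univ : Set X) n, y ∈ openCell n i ∧ closedCell n i ⊆ Y)
    {P : X → Prop}
    (hP : ∀ e : cell (univ : Set X) 1, closedCell 1 e ⊆ Y →
      ∀ u ∈ cellFrontier 1 e, ∀ v ∈ cellFrontier 1 e, P u → P v)
    {x y : X} {i j : cell (univ : Set X) 0} (hx : x ∈ openCell 0 i) (hy : y ∈ openCell 0 j)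
    (h : JoinedIn Y x y) (hPx : P x) : P y := by
  have hpt : ∀ {v : cell (univ : Set X) 0} {z : X}, z ∈ openCell 0 v →
      ∀ z' ∈ openCell 0 v, z' = z := by
    intro v z hz z' hz'
    rw [openCell_zero_eq_singleton, mem_singleton_iff] at hz hz'
    rw [hz, hz']
  obtain ⟨γ, hγ⟩ := h
  have hcon : IsPreconnected (range γ) := isPreconnected_range γ.continuous
  have hrange : range γ ⊆ Y := range_subset_iff.2 hγ
  -- Both ends of an edge in `Y` agree about `P`, so `A P` and `A (¬ P)` are disjoint closed sets
  -- covering `Y`, and the connected image of the path lies in one of them.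
  set A : (X → Prop) → Set X := fun Q =>
    ⋃ (n : ℕ) (j : cellsWithVertices Y Q n), openCell (C := univ) n j.1 with hA
  have hcover : Y ⊆ A P ∪ A fun z => ¬ P z := by
    intro z hz
    obtain ⟨n, hn, k, hk, hkY⟩ := hY z hz
    have hmem : ∀ Q : X → Prop, k ∈ cellsWithVertices Y Q n → z ∈ A Q := fun Q hQ => by
      simp only [hA, mem_iUnion]
      exact ⟨n, ⟨k, hQ⟩, hk⟩
    obtain rfl | rfl : n = 0 ∨ n = 1 := by omega
    · have hkY' := (openCell_subset_closedCell 0 k).trans hkY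
      by_cases hz' : P z
      · exact Or.inl (hmem _ ⟨hkY', fun z' h' => hpt hk z' h' ▸ hz'⟩)
      · exact Or.inr (hmem _ ⟨hkY', fun z' h' => hpt hk z' h' ▸ hz'⟩)
    · by_cases hf : ∀ u ∈ cellFrontier 1 k, P u
      · exact Or.inl (hmem _ ⟨hkY, hf⟩)
      · push Not at hf
        obtain ⟨u, hu, hPu⟩ := hf
        exact Or.inr (hmem _ ⟨hkY, fun v hv hPv => hPu (hP k hkY v hv u hu hPv)⟩)
  -- A common point lies in a single open cell selected for both properties. For an edge the
  -- contradiction comes from an end point, since its frontier is nonempty.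
  have hdisj : A P ∩ (A fun z => ¬ P z) = ∅ := by
    refine eq_empty_of_forall_notMem fun z hz => ?_
    simp only [hA, mem_inter_iff, mem_iUnion] at hz
    obtain ⟨⟨n, ⟨k, hk⟩, hzk⟩, m, ⟨l, hl⟩, hzl⟩ := hz
    obtain ⟨rfl, h⟩ := Sigma.mk.inj (eq_of_mem_openCell hzk hzl)
    obtain rfl := eq_of_heq h
    match n, k, hk, hl, hzk with
    | 0, k, hk, hl, hzk => exact hl.2 z hzk (hk.2 z hzk)
    | 1, k, hk, hl, _ =>
      obtain ⟨u, hu⟩ := nonempty_cellFrontier one_ne_zero k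
      exact hl.2 u hu (hk.2 u hu)
    | _ + 2, _, hk, _, _ => exact hk
  have hvert : ∀ {z : X} {v : cell (univ : Set X) 0}, z ∈ openCell 0 v →
      ∀ Q : X → Prop, z ∈ A Q → Q z := by
    intro z v hv Q hz
    simp only [hA, mem_iUnion] at hz
    obtain ⟨n, ⟨k, hk⟩, hzk⟩ := hz
    obtain ⟨rfl, h⟩ := Sigma.mk.inj (eq_of_mem_openCell hv hzk)
    exact hk.2 z hzk
  rcases isPreconnected_iff_subset_of_disjoint_closed.1 hcon (A P) (A fun z => ¬ P z)
    (isClosed_iUnion_cellsWithVertices Y P) (isClosed_iUnion_cellsWithVertices Y _)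
    (hrange.trans hcover) (by rw [hdisj, inter_empty]) with h | h
  · exact hvert hy P (h ⟨1, γ.target⟩)
  · exact absurd hPx (hvert hx _ (h ⟨0, γ.source⟩))

end OneDimensional

/-! ## Vertices and edges of a control map -/

namespace ControlMap

open Topology.RelCWComplex
open scoped Pointwise

universe u v

variable {G : Type u} [Group G] {M : Type v} [MetricSpace M] {ρ : G →* (M ≃ᵢ M)}
  (D : ControlMap ρ)

/-- The set of vertices. -/
def vertices : Set D.X := {x | ∃ v : cell (univ : Set D.X) 0, x ∈ openCell 0 v}

variable {D}

theorem mem_skeleton_of_mem_vertices {x : D.X} (hx : x ∈ D.vertices) :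
    x ∈ skeleton (univ : Set D.X) 1 := by
  obtain ⟨v, hv⟩ := hx
  exact CWComplex.mem_skeleton_iff.2 ⟨0, by simp, v, hv⟩

theorem smul_mem_vertices (g : G) {x : D.X} (hx : x ∈ D.vertices) : g • x ∈ D.vertices := by
  obtain ⟨v, hv⟩ := hx
  obtain ⟨w, hw⟩ := D.permutes g 0 v
  exact ⟨w, hw ▸ mem_image_of_mem _ hv⟩

theorem eq_one_of_smul_eq {g : G} {x : D.X} (hx : x ∈ D.vertices) (h : g • x = x) : g = 1 := by
  obtain ⟨v, hv⟩ := hx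
  refine D.free g 0 v ?_
  rw [openCell_zero_eq_singleton, mem_singleton_iff] at hv
  rw [openCell_zero_eq_singleton, ← hv, image_singleton, h]

theorem smul_left_injective {x : D.X} (hx : x ∈ D.vertices) :
    Function.Injective fun g : G => g • x := by
  intro g g' h
  have h1 : (g'⁻¹ * g) • x = x := by
    change g • x = g' • x at h
    rw [mul_smul, h, inv_smul_smul]
  exact (inv_mul_eq_one.1 (eq_one_of_smul_eq hx h1)).symm

variable (D) in
theorem exists_finite_vertex_representatives :
    ∃ R : Set D.X, R.Finite ∧ ∀ x ∈ D.vertices, ∃ g : G, g⁻¹ • x ∈ R := by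
  obtain ⟨F, hF⟩ := D.cocompact 0 zero_le_one
  refine ⟨⋃ v ∈ F, openCell 0 v, F.finite_toSet.biUnion fun v _ => ?_, fun x ⟨j, hj⟩ => ?_⟩
  · rw [openCell_zero_eq_singleton]
    exact finite_singleton _
  · obtain ⟨i, hi, g, hg⟩ := hF j
    refine ⟨g, mem_iUnion₂.2 ⟨i, hi, ?_⟩⟩
    rw [← hg] at hj
    obtain ⟨y, hy, rfl⟩ := hj
    simpa using hy

theorem image_smul_closedCell {g : G} {n : ℕ} {i j : cell (univ : Set D.X) n}
    (h : (fun x => g • x) '' openCell n i = openCell n j) :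
    (fun x => g • x) '' closedCell n i = closedCell n j := by
  rw [← closure_openCell_eq_closedCell, ← closure_openCell_eq_closedCell, ← h]
  exact (Homeomorph.smul g).image_closure _

theorem inv_smul_mem_cellFrontier {g : G} {n : ℕ} {i j : cell (univ : Set D.X) n}
    (h : (fun x => g • x) '' openCell n i = openCell n j) {x : D.X} (hx : x ∈ cellFrontier n j)
    (hx' : x ∉ openCell n j) : g⁻¹ • x ∈ cellFrontier n i := by
  have h1 := cellFrontier_subset_closedCell n j hx
  rw [← image_smul_closedCell h] at h1
  obtain ⟨y, hy, rfl⟩ := h1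
  simp only [inv_smul_smul]
  rw [← cellFrontier_union_openCell_eq_closedCell] at hy
  exact hy.resolve_right fun hy' => hx' (h ▸ mem_image_of_mem _ hy')

theorem mem_vertices_of_mem_cellFrontier {e : cell (univ : Set D.X) 1} {x : D.X}
    (hx : x ∈ cellFrontier 1 e) : x ∈ D.vertices :=
  exists_mem_openCell_zero_of_mem_cellFrontier_one hx

variable (D) in
/-- Up to the action of `G` there are finitely many end points of edges. -/
theorem exists_finite_edge_representatives :
    ∃ W ⊆ D.vertices, W.Finite ∧ ∀ e : cell (univ : Set D.X) 1, ∃ g : G,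
      ∀ u ∈ cellFrontier 1 e, g⁻¹ • u ∈ W := by
  obtain ⟨F, hF⟩ := D.cocompact 1 le_rfl
  refine ⟨⋃ e ∈ F, cellFrontier 1 e,
    iUnion₂_subset fun e _ x hx => mem_vertices_of_mem_cellFrontier hx,
    F.finite_toSet.biUnion fun e _ => finite_cellFrontier_one e, fun e => ?_⟩
  obtain ⟨i, hi, g, hg⟩ := hF e
  refine ⟨g, fun u hu => mem_iUnion₂.2 ⟨i, hi, inv_smul_mem_cellFrontier hg hu fun hu' => ?_⟩⟩
  obtain ⟨v, hv⟩ := mem_vertices_of_mem_cellFrontier hu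
  exact absurd (congrArg Sigma.fst (eq_of_mem_openCell hv hu')) zero_ne_one

/-- A choice of group elements labelling the vertices, such that labels of translates of finitely
many given vertices by `g` differ from `g` by finitely many elements. -/
theorem exists_vertex_labelling {W : Set D.X} (hW : W ⊆ D.vertices) (hfin : W.Finite) :
    ∃ (k : D.X → G) (Q : Set G), Q.Finite ∧ ∀ (g : G), ∀ x, g⁻¹ • x ∈ W → g⁻¹ * k x ∈ Q := by
  obtain ⟨R, hR, hk⟩ := exists_finite_vertex_representatives D
  choose! k hk using hk
  -- Here `(k x)⁻¹ • x ∈ R`. With `p = g⁻¹ * k x` and `w = g⁻¹ • x` this reads `p⁻¹ • w ∈ R`; by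
  -- freeness each `w` admits only finitely many such `p`.
  refine ⟨k, ⋃ w ∈ W, {p : G | p⁻¹ • w ∈ R}, hfin.biUnion fun w hw => ?_, fun g x hx => ?_⟩
  · refine hR.preimage (f := fun p : G => p⁻¹ • w) fun p _ q _ hpq => ?_
    exact inv_injective (smul_left_injective (hW hw) hpq)
  · refine mem_iUnion₂.2 ⟨_, hx, ?_⟩
    have hxv : x ∈ D.vertices := by
      simpa using smul_mem_vertices g (hW hx)
    simpa [mul_smul] using hk x hxv

variable (D) in
theorem vertices_nonempty : D.vertices.Nonempty := by
  have : Nonempty D.X := inferInstance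
  obtain ⟨v⟩ := exists_cell_zero (X := D.X)
  obtain ⟨x, hx⟩ := openCell_nonempty 0 v
  exact ⟨x, v, hx⟩

theorem mem_horoball_of_mem_sub {τ : GeodesicRay M} {s : ℝ} {x : D.X} (hx : x ∈ D.sub τ s) :
    D.h x ∈ horoball τ s := by
  simp only [sub, mem_iUnion] at hx
  obtain ⟨E, hE, hx⟩ := hx
  exact (hE hx).2

theorem mem_sub_of_mem_vertices {τ : GeodesicRay M} {s : ℝ} {x : D.X} (hx : x ∈ D.vertices)
    (h : D.h x ∈ horoball τ s) : x ∈ D.sub τ s := by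
  have hsk := mem_skeleton_of_mem_vertices hx
  obtain ⟨v, hv⟩ := hx
  have hI : ∀ y ∈ ⋃ (n : ℕ) (j : cellsWithVertices {x} (fun _ => True) n),
      openCell (C := univ) n j.1, y = x := by
    intro y hy
    simp only [mem_iUnion] at hy
    obtain ⟨n, ⟨j, hj⟩, hy⟩ := hy
    match n, j, hj, hy with
    | 0, j, hj, hy => exact hj.1 hy
    | 1, j, hj, hy => exact hj.1 (openCell_subset_closedCell 1 j hy)
    | _ + 2, j, hj, hy => exact hj.elim
  obtain ⟨E, hE⟩ := exists_subcomplex_eq_iUnion_cellsWithVertices {x} fun _ => True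
  simp only [sub, mem_iUnion]
  refine ⟨E, fun y hy => ?_, ?_⟩
  · rw [hI y (hE ▸ hy)]
    exact ⟨hsk, h⟩
  · rw [hE]
    simp only [mem_iUnion]
    refine ⟨0, ⟨v, ?_, fun _ _ => trivial⟩, hv⟩
    rw [openCell_zero_eq_singleton, mem_singleton_iff] at hv
    rw [openCell_zero_eq_singleton, hv]

/-- This is the form of being a graph that `JoinedIn.iff_of_vertex_property` requires. Disjointness
of open cells identifies the cell given by the subcomplex with the one given by the skeleton, which
bounds its dimension. -/
theorem exists_closedCell_subset_sub {τ : GeodesicRay M} {s : ℝ} {x : D.X}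
    (hx : x ∈ D.sub τ s) : ∃ n ≤ 1, ∃ i : cell (univ : Set D.X) n,
      x ∈ openCell n i ∧ closedCell n i ⊆ D.sub τ s := by
  simp only [sub, mem_iUnion] at hx
  obtain ⟨E, hE, hx⟩ := hx
  have hx' := hx
  rw [← CWComplex.Subcomplex.union] at hx'
  simp only [mem_iUnion] at hx'
  obtain ⟨n, ⟨i, hi⟩, hxi⟩ := hx'
  obtain ⟨m, hm, j, hxj⟩ := CWComplex.mem_skeleton_iff.1 (hE hx).1
  obtain ⟨rfl, h⟩ := Sigma.mk.inj (eq_of_mem_openCell hxi hxj)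
  refine ⟨n, by exact_mod_cast hm, i, hxi, ?_⟩
  exact (CWComplex.Subcomplex.closedCell_subset_of_mem E hi).trans fun y hy =>
    mem_iUnion₂.2 ⟨E, hE, hy⟩

end ControlMap

/-! ## Finite generation from controlled connectivity -/

theorem FinGenOver.of_finite {A B : Type*} [Group A] [Group B] {φ : A →* MulAut B} {A' : Set A}
    {S : Set B} (hS : S.Finite)
    (h : Subgroup.closure {b | ∃ a ∈ A', ∃ s ∈ S, b = φ a s} = ⊤) : FinGenOver φ A' :=
  ⟨hS.toFinset, by simpa using h⟩

theorem exists_finGenOver_of_controlledConnected {α B : Type*} [DecidableEq α] [Group B]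
    {φ : FreeGroup α →* MulAut B} {t : α × Bool} {c : ℕ → α × Bool}
    (hc : ∃ N : ℕ, ∀ i ≥ N, c i = invLetter t) {τ : GeodesicRay (CayleyTree α)}
    (hτ : RepresentedBy τ.endpoint c) (D : ControlMap (semidirectAction φ))
    (hD : D.ControlledConnected τ) :
    ∃ m : ℤ, FinGenOver φ (Set.univ \ expsum t ⁻¹' Set.Ici m) := by
  obtain ⟨lag, -, -, hlag⟩ := hD
  obtain ⟨x₀, hx₀⟩ := D.vertices_nonempty
  obtain ⟨W, hWv, hW, hedge⟩ := D.exists_finite_edge_representatives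
  -- `x₀` is added to `W` so that the labels of `x₀` and `b • x₀` are controlled as well as those of
  -- edge ends.
  obtain ⟨k, Q, hQ, hk⟩ := ControlMap.exists_vertex_labelling
    (insert_subset hx₀ hWv) (hW.insert x₀)
  -- With this `s`, the ball for `l = 0` in the horoball just reaches `D.h x₀`.
  set s : ℝ := -dist (D.h x₀) (τ 0) with hs
  obtain ⟨K, hK⟩ := exists_treeHeight_le_of_mem_horoball hc hτ (s - lag s)
  obtain ⟨K', hK'⟩ := (hW.image fun w => -treeHeight t (D.h w)).bddAbove
  -- If `u = g • w` with `w ∈ W` lies over the larger horoball, then `expsum t g.right` is the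
  -- height of `D.h u` minus that of `D.h w`, at most `K + K'`. Positivity of `m` admits `1` and
  -- `inl b`, of exponent sum `0`.
  obtain ⟨m, hm⟩ := exists_int_gt (max (K + K') 0)
  refine ⟨m, FinGenOver.of_finite (hQ.image SemidirectProduct.left) ?_⟩
  set H := Subgroup.closure {b | ∃ a ∈ Set.univ \ expsum t ⁻¹' Set.Ici m,
    ∃ s ∈ SemidirectProduct.left '' Q, b = φ a s} with hH
  -- `k x = g * q` with `q ∈ Q`, so `(k x).left` is `g.left` times the generator `φ g.right q.left`
  -- of `H`.
  have key : ∀ (g : B ⋊[φ] FreeGroup α) (x : D.X), expsum t g.right < m →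
      g⁻¹ • x ∈ insert x₀ W → ((k x).left ∈ H ↔ g.left ∈ H) := by
    intro g x hg hx
    have h1 : k x = g * (g⁻¹ * k x) := by group
    have h2 : φ g.right (g⁻¹ * k x).left ∈ H :=
      Subgroup.subset_closure
        ⟨g.right, ⟨trivial, by simpa using hg⟩, _, mem_image_of_mem _ (hk g x hx), rfl⟩
    rw [h1, SemidirectProduct.mul_left]
    exact H.mul_mem_cancel_right h2
  have hm0 : 0 < m := by exact_mod_cast (le_max_right _ _).trans_lt hm
  refine eq_top_iff.2 fun b _ => ?_
  have hb₀ : (SemidirectProduct.inl b : B ⋊[φ] FreeGroup α) • x₀ ∈ D.vertices := ControlMap.smul_mem_vertices _ hx₀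
  have hx₀s : D.h x₀ ∈ horoball τ s := by
    simp only [horoball, mem_iUnion, Metric.mem_closedBall]
    refine ⟨0, ?_, ?_⟩ <;> simp [hs]
  have hbs : D.h ((SemidirectProduct.inl b : B ⋊[φ] FreeGroup α) • x₀) ∈ horoball τ s := by
    rw [D.equivariant _ _ (ControlMap.mem_skeleton_of_mem_vertices hx₀), semidirectAction_inl]
    exact hx₀s
  have hjoin := hlag s _ (ControlMap.mem_sub_of_mem_vertices hx₀ hx₀s) _
    (ControlMap.mem_sub_of_mem_vertices hb₀ hbs)
  obtain ⟨i, hi⟩ := hx₀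
  obtain ⟨j, hj⟩ := hb₀
  have hfin := hjoin.iff_of_vertex_property (P := fun x => (k x).left ∈ H)
    (fun y hy => ControlMap.exists_closedCell_subset_sub hy) ?_ hi hj ?_
  -- Membership in `H` of the label's `B`-component carries over from `x₀` to `b • x₀`, where `key`
  -- with `g = inl b` turns it into `b ∈ H`.
  · rw [key (SemidirectProduct.inl b) _ (by simpa [expsum_one] using hm0) (by simp)] at hfin
    simpa using hfin
  · intro e he u hu v hv hPu
    obtain ⟨g, hg⟩ := hedge e
    have hlt : expsum t g.right < m := by
      have h1 := hK _ (ControlMap.mem_horoball_of_mem_sub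
        (he (Topology.RelCWComplex.cellFrontier_subset_closedCell 1 e hu)))
      have h2 := hK' (mem_image_of_mem _ (hg u hu))
      have h3 : D.h u = semidirectAction φ g (D.h (g⁻¹ • u)) := by
        rw [← D.equivariant _ _ (ControlMap.mem_skeleton_of_mem_vertices (hWv (hg u hu))),
          smul_inv_smul]
      rw [h3, treeHeight_semidirectAction] at h1
      have h4 := (le_max_left _ _).trans_lt hm
      have : (expsum t g.right : ℝ) < m := by
        linarith
      exact_mod_cast this
    -- One `g` serves both ends of the edge, so both labels are compared with the same `g.left`.
    exact (key g v hlt (Or.inr (hg v hv))).2 ((key g u hlt (Or.inr (hg u hu))).1 hPu)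
  · exact (key 1 x₀ (by simpa [expsum_one] using hm0) (by simp)).2 (by simp)

theorem mainTheorem4 {n : ℕ} {B : Type*} [Group B] (φ : FreeGroup (Fin n) →* MulAut B)
    (hG : Group.FG (B ⋊[φ] FreeGroup (Fin n))) (t : Fin n × Bool)
    (hB : ¬ ∃ m : ℤ, FinGenOver φ (Set.univ \ expsum t ⁻¹' Set.Ici m))
    (e : Boundary (CayleyTree (Fin n))) (c : ℕ → Fin n × Bool) (he : RepresentedBy e c)
    (hc : ∃ N : ℕ, ∀ i ≥ N, c i = invLetter t) :
    e ∉ Sigma1 (semidirectAction φ) := by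
  rintro ⟨τ, rfl, D, hD⟩
  exact hB (exists_finGenOver_of_controlledConnected hc he D hD)
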